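/- Let $m\ge 0$ and let $\mathcal K$ be a simplicial complex on $[m]=\{1,\dots,m\}$, i.e. a collection of subsets of $[m]$ that contains $\varnothing$ and is closed under taking subsets (it is not required that every $\{i\}$ belongs to $\mathcal K$). A missing face of $\mathcal K$ is a subset $I\subset[m]$ with $I\notin\mathcal K$ all of whose proper subsets belong to $\mathcal K$. For $\mathbb F=\mathbb C$ or $\mathbb R$ let $$U_{\mathbb F}(\mathcal K)=\mathbb F^m\setminus\bigcup_{I\notin\mathcal K}\{z: z_i=0 \text{ for all } i\in I\},\qquad D_{\mathbb F}(\mathcal K)=\mathbb F^m\setminus\bigcup_{I\notin\mathcal K}\{z: z_i=z_j\text{ for all } i,j\in I\}$$ be the complements of the coordinate and of the diagonal subspace arrangement of $\mathcal K$, and let $\Sigma X$ denote the unreduced suspension of a space $X$, that is, $X\times[0,1]$ with $X\times\{0\}$ and $X\times\{1\}$ collapsed to two distinct points (so $\Sigma\varnothing=S^0$). Suppose that any two missing faces of $\mathcal K$ have a common vertex. Then there are homotopy equivalences $$U_{\mathbb C}(\mathcal K)\simeq\Sigma^2 D_{\mathbb C}(\mathcal K)\qquad\text{and}\qquad U_{\mathbb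 R}(\mathcal K)\simeq\Sigma D_{\mathbb R}(\mathcal K).$$ -/

import Mathlib

open scoped ContinuousMap

/-- `I` is a simplex of `K`. Mathlib's `PreAbstractSimplicialComplex` records the nonempty
simplices only; the empty set is a simplex of every simplicial complex. Singletons are not
required to be simplices (ghost vertices are allowed). -/
def IsSimplex {V : Type*} (K : PreAbstractSimplicialComplex V) (I : Finset V) : Prop :=
  I = ∅ ∨ I ∈ K.faces

/-- A missing face: not a simplex, but all of its proper subsets are simplices. -/
def IsMissingFace {V : Type*} (K : PreAbstractSimplicialComplex V) (I : Finset V) : Prop :=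
  ¬ IsSimplex K I ∧ ∀ J : Finset V, J ⊂ I → IsSimplex K J

/-- The coordinate subspace `z_{i_1} = ⋯ = z_{i_k} = 0`, for `I = {i_1, …, i_k}`. -/
def coordinateSubspace (𝕜 : Type*) [Zero 𝕜] {m : ℕ} (I : Finset (Fin m)) : Set (Fin m → 𝕜) :=
  {z | ∀ i ∈ I, z i = 0}

/-- The diagonal subspace `z_{i_1} = ⋯ = z_{i_k}`, for `I = {i_1, …, i_k}`. -/
def diagonalSubspace (𝕜 : Type*) {m : ℕ} (I : Finset (Fin m)) : Set (Fin m → 𝕜) :=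
  {z | ∀ i ∈ I, ∀ j ∈ I, z i = z j}

/-- The coordinate arrangement complement: the points of `𝕜^m` that lie on no coordinate
subspace indexed by a non-simplex of `K`. -/
def coordinateComplement (𝕜 : Type*) [Zero 𝕜] {m : ℕ}
    (K : PreAbstractSimplicialComplex (Fin m)) : Set (Fin m → 𝕜) :=
  (⋃ I ∈ {I : Finset (Fin m) | ¬ IsSimplex K I}, coordinateSubspace 𝕜 I)ᶜ

/-- The diagonal arrangement complement: the points of `𝕜^m` that lie on no diagonal
subspace indexed by a non-simplex of `K`. -/
def diagonalComplement (𝕜 : Type*) {m : ℕ}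
    (K : PreAbstractSimplicialComplex (Fin m)) : Set (Fin m → 𝕜) :=
  (⋃ I ∈ {I : Finset (Fin m) | ¬ IsSimplex K I}, diagonalSubspace 𝕜 I)ᶜ

/-- The gluing relation of the suspension: `X × {0}` is collapsed to the pole `false`
and `X × {1}` to the pole `true`. -/
inductive SuspensionRel (X : Type*) : Bool ⊕ (X × unitInterval) → Bool ⊕ (X × unitInterval) → Prop
  | bottom (x : X) : SuspensionRel X (Sum.inr (x, 0)) (Sum.inl false)
  | top (x : X) : SuspensionRel X (Sum.inr (x, 1)) (Sum.inl true)

/-- The (unreduced) suspension: the cylinder `X × [0,1]` with its two ends collapsed to two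
distinct poles. For nonempty `X` it is the usual quotient of the cylinder; the suspension of the
empty space consists of the two poles. -/
def Suspension (X : Type*) : Type _ := Quot (SuspensionRel X)

/-- The quotient topology. -/
instance {X : Type*} [TopologicalSpace X] : TopologicalSpace (Suspension X) :=
  inferInstanceAs (TopologicalSpace (Quot (SuspensionRel X)))

/-! Let `L` be the union of the diagonal subspaces of the non-simplices and `D` its complement.
Every non-simplex contains a missing face, so any two non-simplices meet. Hence all diagonal
subspaces through a point `z` of `L` have the same common coordinate value `g z`; Tietze extends `g`
to the whole space (`exists_continuous_eq_coordinate`). A point of `L` lies in the coordinate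
arrangement exactly when `g z = 0`, so the graph map `z ↦ (z, g z)` sends `U` into the complement of
`L × {0}`. The shear `(z, t) ↦ z + (t - g z)(1, …, 1)` is a homotopy inverse, because `L` is
invariant under diagonal translations and `g (z + c) = g z + c` there.

For open `D` in a normed space `V`, the complement of `Dᶜ × {0}` in `V × ℝ` is two contractible
half-spaces joined through `D × ℝ`, hence a suspension of `D`
(`Suspension.nonempty_sliceComplement_homotopyEquiv`). A complex last coordinate counts as two real
ones, giving a double suspension. -/

namespace Suspension

/-! ### Suspensions: universal property and homotopy invariance. -/

variable {X Y : Type*}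

/-- The two poles of a suspension. -/
def pole (b : Bool) : Suspension X := Quot.mk _ (Sum.inl b)

/-- The class in the suspension of a point of the cylinder. -/
def point (x : X) (s : unitInterval) : Suspension X := Quot.mk _ (Sum.inr (x, s))

theorem point_zero (x : X) : point x 0 = pole false := Quot.sound (.bottom x)

theorem point_one (x : X) : point x 1 = pole true := Quot.sound (.top x)

theorem induction_on {P : Suspension X → Prop} (q : Suspension X) (hpole : ∀ b, P (pole b))
    (hpoint : ∀ x s, P (point x s)) : P q := by
  induction q using Quot.ind with
  | mk a =>
    rcases a with b | ⟨x, s⟩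
    · exact hpole b
    · exact hpoint x s

variable [TopologicalSpace X] [TopologicalSpace Y]

theorem continuous_point : Continuous fun p : X × unitInterval => point p.1 p.2 :=
  continuous_quot_mk.comp continuous_inr

theorem _root_.Continuous.suspensionPoint {Z : Type*} [TopologicalSpace Z] {f : Z → X}
    {s : Z → unitInterval} (hf : Continuous f) (hs : Continuous s) :
    Continuous fun z => point (f z) (s z) :=
  continuous_point.comp (hf.prodMk hs)

/-- The universal property of the suspension: a map of the cylinder that is constant on either
end descends to the suspension. -/
def desc (p : Bool → Y) (f : C(X × unitInterval, Y)) (h₀ : ∀ x, f (x, 0) = p false)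
    (h₁ : ∀ x, f (x, 1) = p true) : C(Suspension X, Y) where
  toFun := Quot.lift (Sum.elim p f) (by
    rintro _ _ (x | x)
    · exact h₀ x
    · exact h₁ x)
  continuous_toFun :=
    continuous_quot_lift _ (continuous_of_discreteTopology.sumElim f.continuous)

@[simp] theorem desc_pole (p : Bool → Y) (f : C(X × unitInterval, Y)) (h₀ h₁) (b : Bool) :
    desc p f h₀ h₁ (pole b) = p b := rfl

@[simp] theorem desc_point (p : Bool → Y) (f : C(X × unitInterval, Y)) (h₀ h₁) (x : X)
    (s : unitInterval) : desc p f h₀ h₁ (point x s) = f (x, s) := rfl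

/-- A homotopy on the cylinder that is stationary on either end descends to the suspension. -/
theorem homotopic_of_cylinder {f g : C(Suspension X, Y)} (p : Bool → Y)
    (h : C((X × unitInterval) × unitInterval, Y))
    (h₀ : ∀ x r, h ((x, 0), r) = p false) (h₁ : ∀ x r, h ((x, 1), r) = p true)
    (hf : ∀ b, f (pole b) = p b) (hg : ∀ b, g (pole b) = p b)
    (hf' : ∀ x s, f (point x s) = h ((x, s), 0)) (hg' : ∀ x s, g (point x s) = h ((x, s), 1)) :
    f.Homotopic g := by
  -- Currying the time variable lets the homotopy descend by the universal property, with no need to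
  -- know that the quotient map times the interval is a quotient map.
  let H : C(Suspension X, C(unitInterval, Y)) :=
    desc (fun b => ContinuousMap.const _ (p b)) h.curry
      (fun x => ContinuousMap.ext fun r => h₀ x r) (fun x => ContinuousMap.ext fun r => h₁ x r)
  refine ⟨⟨H.uncurry.comp ⟨Prod.swap, continuous_swap⟩, fun q => ?_, fun q => ?_⟩⟩
  · induction q using induction_on with
    | hpole b => exact (hf b).symm
    | hpoint x s => exact (hf' x s).symm
  · induction q using induction_on with
    | hpole b => exact (hg b).symm
    | hpoint x s => exact (hg' x s).symm

/-- The suspension of a continuous map. -/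
def map (f : C(X, Y)) : C(Suspension X, Suspension Y) :=
  desc pole ⟨fun q => point (f q.1) q.2, .suspensionPoint (by fun_prop) (by fun_prop)⟩
    (fun x => point_zero (f x)) (fun x => point_one (f x))

theorem map_point (f : C(X, Y)) (x : X) (s : unitInterval) :
    map f (point x s) = point (f x) s := rfl

theorem map_homotopic {f g : C(X, Y)} (h : f.Homotopic g) : (map f).Homotopic (map g) := by
  obtain ⟨h⟩ := h
  refine homotopic_of_cylinder pole
    ⟨fun q => point (h (q.2, q.1.1)) q.1.2, .suspensionPoint (by fun_prop) (by fun_prop)⟩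
    (fun x r => point_zero _) (fun x r => point_one _) (fun b => rfl) (fun b => rfl)
    (fun x s => ?_) (fun x s => ?_)
  · simp [map_point]
  · simp [map_point]

theorem map_comp {Z : Type*} [TopologicalSpace Z] (g : C(Y, Z)) (f : C(X, Y)) :
    map (g.comp f) = (map g).comp (map f) := by
  ext q
  induction q using induction_on <;> rfl

theorem map_id : map (ContinuousMap.id X) = ContinuousMap.id _ := by
  ext q
  induction q using induction_on <;> rfl

/-- Suspension preserves homotopy equivalences. -/
def congr (e : X ≃ₕ Y) : Suspension X ≃ₕ Suspension Y where
  toFun := map e.toFun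
  invFun := map e.invFun
  left_inv := by
    rw [← map_comp, ← map_id]
    exact map_homotopic e.left_inv
  right_inv := by
    rw [← map_comp, ← map_id]
    exact map_homotopic e.right_inv

end Suspension

/-! ### Straight-line homotopies and slice complements. -/

/-- Two maps into a subset of a vector space are homotopic if the segments joining their values
lie in the subset. -/
theorem ContinuousMap.homotopic_of_segment_subset {X E : Type*} [TopologicalSpace X]
    [AddCommGroup E] [Module ℝ E] [TopologicalSpace E] [ContinuousAdd E] [ContinuousSMul ℝ E]
    {S : Set E} (f g : C(X, S)) (h : ∀ x, segment ℝ (f x : E) (g x) ⊆ S) : f.Homotopic g := by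
  refine ⟨⟨⟨fun q => ⟨(1 - (q.1 : ℝ)) • (f q.2 : E) + (q.1 : ℝ) • (g q.2 : E), ?_⟩, ?_⟩,
    fun x => ?_, fun x => ?_⟩⟩
  · exact h q.2 ⟨1 - q.1, q.1, by linarith [q.1.2.2], q.1.2.1, by ring, rfl⟩
  · exact Continuous.subtype_mk (by fun_prop) _
  · simp
  · simp

/-- The complement of `Dᶜ × {0}` in `V × 𝕜`. -/
def sliceComplement (𝕜 : Type*) [Zero 𝕜] {V : Type*} (D : Set V) : Set (V × 𝕜) :=
  {p | p.2 ≠ 0 ∨ p.1 ∈ D}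

theorem IsOpen.sliceComplement {V 𝕜 : Type*} [TopologicalSpace V] [TopologicalSpace 𝕜] [T2Space 𝕜]
    [Zero 𝕜] {D : Set V} (hD : IsOpen D) : IsOpen (sliceComplement 𝕜 D) :=
  (isOpen_ne_fun continuous_snd continuous_const).union (hD.preimage continuous_fst)

/-- An open subset of a metric space is the positivity set of a continuous function that is at
most `1`. -/
theorem IsOpen.exists_continuous_pos_iff {V : Type*} [PseudoMetricSpace V] {D : Set V}
    (hD : IsOpen D) :
    ∃ d : C(V, ℝ), (∀ v, d v ≤ 1) ∧ ∀ v, 0 < d v ↔ v ∈ D := by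
  -- `Metric.infDist` to the empty set is `0`, so `D = V` needs its own function.
  rcases Dᶜ.eq_empty_or_nonempty with h | h
  · refine ⟨ContinuousMap.const _ 1, fun v => le_rfl, fun v => ?_⟩
    simp [Set.compl_empty_iff.1 h]
  · refine ⟨⟨fun v => min 1 (Metric.infDist v Dᶜ),
      continuous_const.min (Metric.continuous_infDist_pt _)⟩,
      fun v => min_le_left _ _, fun v => ?_⟩
    simp [← hD.isClosed_compl.notMem_iff_infDist_pos h]

/-! ### The slice complement of an open set as a suspension. -/

namespace Suspension

/-- The rescaling of `[-1, 1]` to the unit interval, extended by constants. -/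
noncomputable def level (u : ℝ) : unitInterval := Set.projIcc 0 1 zero_le_one ((1 + u) / 2)

theorem continuous_level : Continuous level := continuous_projIcc.comp (by fun_prop)

theorem level_of_one_le {u : ℝ} (hu : 1 ≤ u) : level u = 1 :=
  Set.projIcc_of_right_le _ (by linarith)

theorem level_of_le_neg_one {u : ℝ} (hu : u ≤ -1) : level u = 0 :=
  Set.projIcc_of_le_left _ (by linarith)

theorem level_two_mul_sub_one (s : unitInterval) : level (2 * s - 1) = s := by
  unfold level
  rw [show (1 + (2 * (s : ℝ) - 1)) / 2 = s by ring]
  exact Set.projIcc_val zero_le_one s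

theorem coe_level (u : ℝ) : 2 * (level u : ℝ) - 1 = max (-1) (min 1 u) := by
  simp only [level, Set.coe_projIcc]
  grind

variable {V : Type*} {D : Set V}

open Classical in
/-- The map from the complement of `Dᶜ × {0}` to the suspension of `D` that keeps the first
coordinate and rescales the second by `d`. -/
noncomputable def collapseFun (D : Set V) (d : V → ℝ) (p : V × ℝ) : Suspension D :=
  if h : p.1 ∈ D then point ⟨p.1, h⟩ (level (p.2 / d p.1)) else pole (decide (0 < p.2))

theorem collapseFun_of_mem {d : V → ℝ} {p : V × ℝ} (h : p.1 ∈ D) :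
    collapseFun D d p = point ⟨p.1, h⟩ (level (p.2 / d p.1)) := dif_pos h

theorem collapseFun_of_le {d : V → ℝ} (hd : ∀ v, 0 < d v ↔ v ∈ D) {p : V × ℝ} (hp : 0 < p.2)
    (h : d p.1 ≤ p.2) : collapseFun D d p = pole true := by
  by_cases hv : p.1 ∈ D
  · rw [collapseFun_of_mem hv, level_of_one_le ((one_le_div ((hd _).2 hv)).2 h), point_one]
  · simp [collapseFun, hv, hp]

theorem collapseFun_of_le_neg {d : V → ℝ} (hd : ∀ v, 0 < d v ↔ v ∈ D) {p : V × ℝ} (hp : p.2 < 0)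
    (h : p.2 ≤ -d p.1) : collapseFun D d p = pole false := by
  by_cases hv : p.1 ∈ D
  · have := (hd _).2 hv
    rw [collapseFun_of_mem hv, level_of_le_neg_one ((div_le_iff₀ this).2 (by linarith)), point_zero]
  · simp [collapseFun, hv, hp.not_gt]

/-- Over a point outside `D` the height is nonzero while `d ≤ 0`, so nearby `d` stays below the
absolute value of the height and the map is locally constant at a pole. -/
theorem continuousOn_collapseFun [TopologicalSpace V] (hD : IsOpen D) {d : C(V, ℝ)}
    (hd : ∀ v, 0 < d v ↔ v ∈ D) : ContinuousOn (collapseFun D d) (sliceComplement ℝ D) := by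
  intro p hp
  apply ContinuousAt.continuousWithinAt
  by_cases hv : p.1 ∈ D
  · have hopen : IsOpen {q : V × ℝ | q.1 ∈ D} := hD.preimage continuous_fst
    refine ContinuousOn.continuousAt (s := {q : V × ℝ | q.1 ∈ D}) ?_ (hopen.mem_nhds hv)
    rw [continuousOn_iff_continuous_domRestrict]
    have : Set.domRestrict {q : V × ℝ | q.1 ∈ D} (collapseFun D d) =
        (fun r : D × unitInterval => point r.1 r.2) ∘
          fun q => (⟨q.1.1, q.2⟩, level (q.1.2 / d q.1.1)) := by
      funext q
      exact collapseFun_of_mem q.2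
    rw [this]
    refine continuous_point.comp (.prodMk (.subtype_mk (by fun_prop) _) (continuous_level.comp ?_))
    exact Continuous.div (by fun_prop) (by fun_prop) fun q => ((hd _).2 q.2).ne'
  · have hdp : d p.1 ≤ 0 := not_lt.1 fun h => hv ((hd _).1 h)
    rcases lt_or_gt_of_ne (hp.resolve_right hv) with ht | ht
    · have h₁ : ∀ᶠ q : V × ℝ in nhds p, q.2 < 0 :=
        (continuous_snd.tendsto p).eventually_lt_const ht
      have h₂ : ∀ᶠ q : V × ℝ in nhds p, q.2 + d q.1 < 0 :=
        (Continuous.tendsto (by fun_prop) p).eventually_lt_const (by linarith)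
      refine (continuousAt_const (y := pole false)).congr ?_
      filter_upwards [h₁, h₂] with q hq hq'
      exact (collapseFun_of_le_neg hd hq (by linarith)).symm
    · have h₁ : ∀ᶠ q : V × ℝ in nhds p, 0 < q.2 :=
        (continuous_snd.tendsto p).eventually_const_lt ht
      have h₂ : ∀ᶠ q : V × ℝ in nhds p, 0 < q.2 - d q.1 :=
        (Continuous.tendsto (by fun_prop) p).eventually_const_lt (by linarith)
      refine (continuousAt_const (y := pole true)).congr ?_
      filter_upwards [h₁, h₂] with q hq hq'
      exact (collapseFun_of_le hd hq (by linarith)).symm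

/-- `collapseFun` as a continuous map. -/
noncomputable def collapse [TopologicalSpace V] (hD : IsOpen D) (d : C(V, ℝ))
    (hd : ∀ v, 0 < d v ↔ v ∈ D) : C(sliceComplement ℝ D, Suspension D) :=
  ⟨_, continuousOn_iff_continuous_domRestrict.1 (continuousOn_collapseFun hD hd)⟩

variable [NormedAddCommGroup V] [NormedSpace ℝ V]

/-- Only at height `0` must the first coordinate stay in `D`; elsewhere it may be contracted freely.
-/
theorem smul_mem_sliceComplement {c u : ℝ} (hc : u = 0 → c = 1) {v : V} (hv : v ∈ D) :
    (c • v, u) ∈ sliceComplement ℝ D := by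
  by_cases hu : u = 0
  · exact Or.inr (by simpa [hc hu] using hv)
  · exact Or.inl hu

/-- The map from the suspension of `D` to the complement of `Dᶜ × {0}` that contracts `D` to the
origin towards either pole. -/
noncomputable def spread (D : Set V) : C(Suspension D, sliceComplement ℝ D) :=
  desc (fun b => ⟨(0, if b then 1 else -1), Or.inl (by cases b <;> simp)⟩)
    ⟨fun q => ⟨((1 - |2 * (q.2 : ℝ) - 1|) • (q.1 : V), 2 * (q.2 : ℝ) - 1),
      smul_mem_sliceComplement (fun h => by simp [h]) q.1.2⟩,
      Continuous.subtype_mk (by fun_prop) _⟩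
    (fun x => Subtype.ext (by simp)) (fun x => Subtype.ext (by norm_num))

theorem coe_spread_pole (b : Bool) : (spread D (pole b) : V × ℝ) = (0, if b then 1 else -1) := rfl

theorem coe_spread_point (x : D) (s : unitInterval) :
    (spread D (point x s) : V × ℝ) = ((1 - |2 * (s : ℝ) - 1|) • (x : V), 2 * (s : ℝ) - 1) := rfl

variable {d : C(V, ℝ)}

/-- The composite fixes the points of height `0` and preserves the sign of every other height, so
the straight-line homotopy avoids `Dᶜ × {0}`. -/
theorem spread_comp_collapse (hD : IsOpen D) (hd : ∀ v, 0 < d v ↔ v ∈ D) :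
    ((spread D).comp (collapse hD d hd)).Homotopic (ContinuousMap.id _) := by
  apply ContinuousMap.homotopic_of_segment_subset
  rintro ⟨⟨v, t⟩, hp⟩
  rintro _ ⟨a, b, ha, hb, hab, rfl⟩
  change a • (spread D (collapseFun D d (v, t)) : V × ℝ) + b • (v, t) ∈ _
  by_cases ht : t = 0
  · subst ht
    have hv : v ∈ D := by simpa [sliceComplement] using hp
    rw [collapseFun_of_mem (p := (v, 0)) hv, coe_spread_point, coe_level]
    refine Or.inr ?_
    simpa [← add_smul, hab] using hv
  · left
    have key : ∃ u : ℝ, (spread D (collapseFun D d (v, t)) : V × ℝ).2 = u ∧ 0 < u * t := by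
      by_cases hv : v ∈ D
      · rw [collapseFun_of_mem (p := (v, t)) hv, coe_spread_point, coe_level]
        refine ⟨_, rfl, ?_⟩
        have hdv := (hd v).2 hv
        rcases lt_or_gt_of_ne ht with h | h
        · have : t / d v < 0 := div_neg_of_neg_of_pos h hdv
          exact mul_pos_of_neg_of_neg (by grind) h
        · have : 0 < t / d v := div_pos h hdv
          exact mul_pos (by grind) h
      · have hdv : d v ≤ 0 := not_lt.1 fun h => hv ((hd _).1 h)
        rcases lt_or_gt_of_ne ht with h | h
        · rw [collapseFun_of_le_neg hd h (by simp; linarith), coe_spread_pole]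
          exact ⟨_, rfl, by simpa using h⟩
        · rw [collapseFun_of_le hd h (by simp; linarith), coe_spread_pole]
          exact ⟨_, rfl, by simpa using h⟩
    obtain ⟨u, hu, hut⟩ := key
    simp only [Prod.snd_add, Prod.smul_snd, hu, smul_eq_mul]
    intro h
    have h' : a * (u * t) + b * (t * t) = 0 := by linear_combination t * h
    have htt : 0 < t * t := mul_self_pos.2 ht
    have h₁ := mul_nonneg ha hut.le
    have h₂ := mul_nonneg hb htt.le
    rcases mul_eq_zero.1 (show a * (u * t) = 0 by linarith) with h₃ | h₃
    · rcases mul_eq_zero.1 (show b * (t * t) = 0 by linarith) with h₄ | h₄ <;> linarith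
    · linarith

/-- The composite contracts the point and rescales the level. The contraction is undone first,
reaching `middle`, and then the rescaling. The bound `d ≤ 1` keeps the poles fixed throughout. -/
theorem collapse_comp_spread (hD : IsOpen D) (hd : ∀ v, 0 < d v ↔ v ∈ D) (hd₁ : ∀ v, d v ≤ 1) :
    ((collapse hD d hd).comp (spread D)).Homotopic (ContinuousMap.id _) := by
  let middle : C(Suspension D, Suspension D) :=
    desc pole ⟨fun q => point q.1 (level ((2 * (q.2 : ℝ) - 1) / d q.1)),
        continuous_fst.suspensionPoint (continuous_level.comp
          (.div (by fun_prop) (by fun_prop) fun q => ((hd _).2 q.1.2).ne'))⟩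
      (fun x => by
        have := (hd _).2 x.2
        simp only [ContinuousMap.coe_mk]
        rw [level_of_le_neg_one, point_zero]
        rw [div_le_iff₀ this]
        simpa using hd₁ x)
      (fun x => by
        have := (hd _).2 x.2
        simp only [ContinuousMap.coe_mk]
        rw [level_of_one_le, point_one]
        rw [one_le_div this]
        norm_num
        exact hd₁ x)
  have hpole : ∀ b, collapseFun D d (spread D (pole b)) = pole b := by
    intro b
    rw [coe_spread_pole]
    cases b
    · exact collapseFun_of_le_neg hd (by simp) (by simpa using hd₁ 0)
    · exact collapseFun_of_le hd (by simp) (by simpa using hd₁ 0)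
  have first : ((collapse hD d hd).comp (spread D)).Homotopic middle := by
    symm
    -- The contracted points may leave `D`, so the homotopy runs in the slice complement and is then
    -- collapsed.
    let H : C((D × unitInterval) × unitInterval, sliceComplement ℝ D) :=
      ⟨fun q => ⟨((1 - (q.2 : ℝ) * |2 * (q.1.2 : ℝ) - 1|) • (q.1.1 : V), 2 * (q.1.2 : ℝ) - 1),
        smul_mem_sliceComplement (fun h => by simp [h]) q.1.1.2⟩,
        Continuous.subtype_mk (by fun_prop) _⟩
    refine homotopic_of_cylinder pole ((collapse hD d hd).comp H) (fun x r => ?_) (fun x r => ?_)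
      (fun b => rfl) hpole (fun x s => ?_) (fun x s => ?_)
    · exact collapseFun_of_le_neg hd (by simp [H]) (by simpa [H] using hd₁ _)
    · refine collapseFun_of_le hd (by norm_num [H]) ?_
      have := hd₁ ((1 - (r : ℝ)) • (x : V))
      norm_num [H]
      exact this
    · have hx : ((1 - ((0 : unitInterval) : ℝ) * |2 * (s : ℝ) - 1|) • (x : V)) = x := by simp
      change _ = collapseFun D d ((1 - ((0 : unitInterval) : ℝ) * |2 * (s : ℝ) - 1|) • (x : V), _)
      rw [hx, collapseFun_of_mem (p := ((x : V), _)) x.2]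
      rfl
    · change collapseFun D d (spread D (point x s)) = collapseFun D d _
      rw [coe_spread_point]
      simp [H]
  refine first.trans ?_
  -- Linear interpolation of heights from `(2s - 1) / d x` to `2s - 1`; at the ends its absolute
  -- value stays at least `1`.
  refine homotopic_of_cylinder pole
    ⟨fun q => point q.1.1 (level ((1 - (q.2 : ℝ)) * ((2 * (q.1.2 : ℝ) - 1) / d q.1.1) +
        q.2 * (2 * (q.1.2 : ℝ) - 1))), .suspensionPoint (by fun_prop) (continuous_level.comp
          (.add (.mul (by fun_prop)
            (.div (by fun_prop) (by fun_prop) fun q => ((hd _).2 q.1.1.2).ne')) (by fun_prop)))⟩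
      (fun x r => ?_) (fun x r => ?_)
      (fun b => rfl) (fun b => rfl) (fun x s => ?_) (fun x s => ?_)
  · have h₁ : 1 ≤ 1 / d x := (one_le_div ((hd _).2 x.2)).2 (hd₁ x)
    have h₂ := mul_le_mul_of_nonneg_left h₁ (sub_nonneg.2 r.2.2)
    simp only [ContinuousMap.coe_mk]
    rw [level_of_le_neg_one, point_zero]
    have : (2 * ((0 : unitInterval) : ℝ) - 1) = -1 := by simp
    rw [this, neg_div]
    linarith
  · have h₁ : 1 ≤ 1 / d x := (one_le_div ((hd _).2 x.2)).2 (hd₁ x)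
    have h₂ := mul_le_mul_of_nonneg_left h₁ (sub_nonneg.2 r.2.2)
    simp only [ContinuousMap.coe_mk]
    rw [level_of_one_le, point_one]
    have : (2 * ((1 : unitInterval) : ℝ) - 1) = 1 := by norm_num
    rw [this]
    linarith
  · simp [middle]
  · simp [level_two_mul_sub_one]

/-- For an open subset `D` of a normed space `V`, the complement of `Dᶜ × {0}` in `V × ℝ` is
homotopy equivalent to the suspension of `D`. -/
theorem nonempty_sliceComplement_homotopyEquiv (hD : IsOpen D) :
    Nonempty (sliceComplement ℝ D ≃ₕ Suspension D) := by
  obtain ⟨d, hd₁, hd⟩ := hD.exists_continuous_pos_iff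
  exact ⟨⟨collapse hD d hd, spread D, spread_comp_collapse hD hd,
    collapse_comp_spread hD hd hd₁⟩⟩

end Suspension

/-! ### Non-simplices and missing faces. -/

theorem exists_isMissingFace_subset {V : Type*} {K : PreAbstractSimplicialComplex V}
    {I : Finset V} (hI : ¬ IsSimplex K I) : ∃ J ⊆ I, IsMissingFace K J := by
  induction I using Finset.strongInduction with
  | H I ih =>
    by_cases h : ∀ J ⊂ I, IsSimplex K J
    · exact ⟨I, subset_rfl, hI, h⟩
    · push Not at h
      obtain ⟨J, hJI, hJ⟩ := h
      obtain ⟨L, hL, hL'⟩ := ih J hJI hJ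
      exact ⟨L, hL.trans hJI.subset, hL'⟩

theorem nonempty_of_not_isSimplex {V : Type*} {K : PreAbstractSimplicialComplex V}
    {I : Finset V} (hI : ¬ IsSimplex K I) : I.Nonempty :=
  Finset.nonempty_iff_ne_empty.2 fun h => hI (Or.inl h)

/-! ### From the coordinate arrangement to the diagonal one. -/

section Arrangements

variable {𝕜 : Type*} {m : ℕ} {K : PreAbstractSimplicialComplex (Fin m)}

theorem mem_coordinateComplement [Zero 𝕜] {z : Fin m → 𝕜} :
    z ∈ coordinateComplement 𝕜 K ↔ ∀ I, ¬ IsSimplex K I → z ∉ coordinateSubspace 𝕜 I := by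
  simp [coordinateComplement]

theorem mem_diagonalComplement {z : Fin m → 𝕜} :
    z ∈ diagonalComplement 𝕜 K ↔ ∀ I, ¬ IsSimplex K I → z ∉ diagonalSubspace 𝕜 I := by
  simp [diagonalComplement]

theorem isClosed_diagonalSubspace [TopologicalSpace 𝕜] [T2Space 𝕜] (I : Finset (Fin m)) :
    IsClosed (diagonalSubspace 𝕜 I) := by
  simp only [diagonalSubspace, Set.ofPred_forall]
  exact isClosed_iInter fun i => isClosed_iInter fun _ => isClosed_iInter fun j =>
    isClosed_iInter fun _ => isClosed_eq (by fun_prop) (by fun_prop)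

theorem isOpen_diagonalComplement [TopologicalSpace 𝕜] [T2Space 𝕜] :
    IsOpen (diagonalComplement 𝕜 K) :=
  isOpen_compl_iff.2 <| (Set.toFinite _).isClosed_biUnion fun I _ => isClosed_diagonalSubspace I

theorem add_const_mem_diagonalComplement [AddGroup 𝕜] {z : Fin m → 𝕜}
    (hz : z ∈ diagonalComplement 𝕜 K) (c : 𝕜) : (fun i => z i + c) ∈ diagonalComplement 𝕜 K := by
  rw [mem_diagonalComplement] at hz ⊢
  exact fun I hI h => hz I hI fun i hi j hj => add_right_cancel (h i hi j hj)

variable [RCLike 𝕜]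

/-- If any two non-simplices meet, the common value of the coordinates indexed by a non-simplex
extends to a continuous function on the whole space. -/
theorem exists_continuous_eq_coordinate
    (hK : ∀ I J, ¬ IsSimplex K I → ¬ IsSimplex K J → ∃ v, v ∈ I ∧ v ∈ J) :
    ∃ g : C(Fin m → 𝕜, 𝕜), ∀ I, ¬ IsSimplex K I → ∀ z ∈ diagonalSubspace 𝕜 I, ∀ i ∈ I,
      g z = z i := by
  have hval : ∀ z : Fin m → 𝕜, ∃ c : 𝕜, ∀ I, ¬ IsSimplex K I → z ∈ diagonalSubspace 𝕜 I →
      ∀ i ∈ I, c = z i := by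
    intro z
    by_cases h : ∃ J, ¬ IsSimplex K J ∧ z ∈ diagonalSubspace 𝕜 J
    · obtain ⟨J, hJ, hzJ⟩ := h
      obtain ⟨j, hj⟩ := nonempty_of_not_isSimplex hJ
      refine ⟨z j, fun I hI hzI i hi => ?_⟩
      obtain ⟨v, hvI, hvJ⟩ := hK I J hI hJ
      exact (hzJ j hj v hvJ).trans (hzI v hvI i hi)
    · exact ⟨0, fun I hI hzI => (h ⟨I, hI, hzI⟩).elim⟩
  choose f hf using hval
  let S : {I : Finset (Fin m) // ¬ IsSimplex K I} → Set (Fin m → 𝕜) :=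
    fun I => diagonalSubspace 𝕜 I.1
  -- On each of these finitely many closed sets `f` agrees with a coordinate.
  have hcont : ContinuousOn f (⋃ I, S I) := by
    refine (locallyFinite_of_finite S).continuousOn_iUnion
      (fun I => isClosed_diagonalSubspace I.1) fun I => ?_
    obtain ⟨i, hi⟩ := nonempty_of_not_isSimplex I.2
    exact (continuous_apply i).continuousOn.congr fun z hz => hf z I.1 I.2 hz i hi
  have hclosed : IsClosed (⋃ I, S I) :=
    isClosed_iUnion_of_finite fun I => isClosed_diagonalSubspace I.1
  obtain ⟨g, hg⟩ := ContinuousMap.exists_restrict_eq hclosed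
    ⟨_, continuousOn_iff_continuous_domRestrict.1 hcont⟩
  refine ⟨g, fun I hI z hz i hi => ?_⟩
  have hz' : z ∈ ⋃ I, S I := Set.mem_iUnion.2 ⟨⟨I, hI⟩, hz⟩
  exact (DFunLike.congr_fun hg ⟨z, hz'⟩).trans (hf z I hI hz i hi)

/-- If any two non-simplices meet, the coordinate arrangement complement is homotopy equivalent to
the complement of `L × {0}`, where `L` is the union of the diagonal arrangement. -/
theorem nonempty_coordinateComplement_homotopyEquiv
    (hK : ∀ I J, ¬ IsSimplex K I → ¬ IsSimplex K J → ∃ v, v ∈ I ∧ v ∈ J) :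
    Nonempty (coordinateComplement 𝕜 K ≃ₕ sliceComplement 𝕜 (diagonalComplement 𝕜 K)) := by
  obtain ⟨g, hg⟩ := exists_continuous_eq_coordinate (𝕜 := 𝕜) hK
  have hgraph : ∀ z ∈ coordinateComplement 𝕜 K,
      (z, g z) ∈ sliceComplement 𝕜 (diagonalComplement 𝕜 K) := by
    intro z hz
    by_contra h
    simp only [sliceComplement, Set.mem_ofPred_eq, not_or, not_not, mem_diagonalComplement,
      not_forall] at h
    obtain ⟨h₀, I, hI, hzI⟩ := h
    exact mem_coordinateComplement.1 hz I hI fun i hi => (hg I hI z hzI i hi).symm.trans h₀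
  have hshear : ∀ p ∈ sliceComplement 𝕜 (diagonalComplement 𝕜 K),
      (fun i => p.1 i + (p.2 - g p.1)) ∈ coordinateComplement 𝕜 K := by
    rintro ⟨z, t⟩ hp
    rw [mem_coordinateComplement]
    intro I hI h
    have hz : ∀ i ∈ I, z i = g z - t := fun i hi => by linear_combination h i hi
    have hzI : z ∈ diagonalSubspace 𝕜 I := fun i hi j hj => (hz i hi).trans (hz j hj).symm
    obtain ⟨i, hi⟩ := nonempty_of_not_isSimplex hI
    rcases hp with hp | hp
    · exact hp (by linear_combination hz i hi + hg I hI z hzI i hi)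
    · exact mem_diagonalComplement.1 hp I hI hzI
  let F : C(coordinateComplement 𝕜 K, sliceComplement 𝕜 (diagonalComplement 𝕜 K)) :=
    ⟨fun z => ⟨(z.1, g z.1), hgraph z.1 z.2⟩, .subtype_mk (by fun_prop) _⟩
  let G : C(sliceComplement 𝕜 (diagonalComplement 𝕜 K), coordinateComplement 𝕜 K) :=
    ⟨fun p => ⟨fun i => p.1.1 i + (p.1.2 - g p.1.1), hshear p.1 p.2⟩, .subtype_mk (by fun_prop) _⟩
  refine ⟨⟨F, G, ?_, ?_⟩⟩
  · have : G.comp F = ContinuousMap.id _ := by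
      ext z i
      simp [F, G]
    rw [this]
  · apply ContinuousMap.homotopic_of_segment_subset
    rintro ⟨⟨z, t⟩, hp⟩ _ ⟨a, b, ha, hb, hab, rfl⟩
    have hab' : (a : 𝕜) + (b : 𝕜) = 1 := by exact_mod_cast hab
    -- For `z` in `D` the segment moves `z` only by diagonal translations, which preserve `D`.
    -- Otherwise `g` commutes with the translation, so the height stays equal to `t ≠ 0`.
    by_cases hz : z ∈ diagonalComplement 𝕜 K
    · right
      convert add_const_mem_diagonalComplement hz ((a : 𝕜) * (t - g z)) using 1
      funext i
      simp only [ContinuousMap.comp_apply, F, G, ContinuousMap.coe_mk, ContinuousMap.id_apply,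
        Prod.fst_add, Prod.smul_fst, Pi.add_apply, Pi.smul_apply, RCLike.real_smul_eq_coe_mul]
      linear_combination z i * hab'
    · left
      have ht : t ≠ 0 := hp.resolve_right hz
      obtain ⟨I, hI, hzI⟩ : ∃ I, ¬ IsSimplex K I ∧ z ∈ diagonalSubspace 𝕜 I := by
        simpa [mem_diagonalComplement] using hz
      obtain ⟨i, hi⟩ := nonempty_of_not_isSimplex hI
      have hgz := hg I hI z hzI i hi
      have hgz' : g (fun j => z j + (t - g z)) = z i + (t - g z) :=
        hg I hI _ (fun j hj k hk => congrArg (· + _) (hzI j hj k hk)) i hi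
      simp only [ContinuousMap.comp_apply, F, G, ContinuousMap.coe_mk, ContinuousMap.id_apply,
        Prod.snd_add, Prod.smul_snd, RCLike.real_smul_eq_coe_mul]
      rw [show (a : 𝕜) * g (fun j => z j + (t - g z)) + b * t = t by
        rw [hgz', ← hgz]
        linear_combination t * hab']
      exact ht

end Arrangements

/-! ### The complex case as two real slices, and the conclusion. -/

/-- Removing `Dᶜ × {0}` from `V × ℂ` amounts to removing `Dᶜ × {0} × {0}` from `V × ℝ × ℝ`. -/
def sliceComplementComplexHomeomorph {V : Type*} [TopologicalSpace V] (D : Set V) :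
    sliceComplement ℂ D ≃ₜ sliceComplement ℝ (sliceComplement ℝ D) where
  toFun p := ⟨((p.1.1, p.1.2.re), p.1.2.im), by
    have := p.2
    simp only [sliceComplement, Set.mem_ofPred_eq, ne_eq, Complex.ext_iff, Complex.zero_re,
      Complex.zero_im] at this ⊢
    tauto⟩
  invFun p := ⟨(p.1.1.1, ⟨p.1.1.2, p.1.2⟩), by
    have := p.2
    simp only [sliceComplement, Set.mem_ofPred_eq, ne_eq, Complex.ext_iff, Complex.zero_re,
      Complex.zero_im] at this ⊢
    tauto⟩
  left_inv p := rfl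
  right_inv p := rfl
  continuous_toFun := .subtype_mk (by fun_prop) _
  continuous_invFun := by
    refine .subtype_mk (.prodMk (by fun_prop) ?_) _
    exact Complex.equivRealProdCLM.symm.continuous.comp
      (f := fun p : sliceComplement ℝ (sliceComplement ℝ D) => (p.1.1.2, p.1.2)) (by fun_prop)

theorem theorem4 (m : ℕ) (K : PreAbstractSimplicialComplex (Fin m))
    (hK : ∀ I J : Finset (Fin m), IsMissingFace K I → IsMissingFace K J →
      ∃ v : Fin m, v ∈ I ∧ v ∈ J) :
    Nonempty (coordinateComplement ℂ K ≃ₕ Suspension (Suspension (diagonalComplement ℂ K))) ∧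
      Nonempty (coordinateComplement ℝ K ≃ₕ Suspension (diagonalComplement ℝ K)) := by
  have hmeet : ∀ I J, ¬ IsSimplex K I → ¬ IsSimplex K J → ∃ v, v ∈ I ∧ v ∈ J := by
    intro I J hI hJ
    obtain ⟨I', hI', hI''⟩ := exists_isMissingFace_subset hI
    obtain ⟨J', hJ', hJ''⟩ := exists_isMissingFace_subset hJ
    obtain ⟨v, hv, hv'⟩ := hK I' J' hI'' hJ''
    exact ⟨v, hI' hv, hJ' hv'⟩
  constructor
  · obtain ⟨e₁⟩ := nonempty_coordinateComplement_homotopyEquiv (𝕜 := ℂ) hmeet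
    have hD := isOpen_diagonalComplement (𝕜 := ℂ) (K := K)
    obtain ⟨e₂⟩ := Suspension.nonempty_sliceComplement_homotopyEquiv hD
    obtain ⟨e₃⟩ := Suspension.nonempty_sliceComplement_homotopyEquiv
      (hD.sliceComplement (𝕜 := ℝ))
    exact ⟨e₁.trans <| (sliceComplementComplexHomeomorph _).toHomotopyEquiv.trans <|
      e₃.trans (Suspension.congr e₂)⟩
  · obtain ⟨e₁⟩ := nonempty_coordinateComplement_homotopyEquiv (𝕜 := ℝ) hmeet
    obtain ⟨e₂⟩ := Suspension.nonempty_sliceComplement_homotopyEquiv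
      (isOpen_diagonalComplement (𝕜 := ℝ) (K := K))
    exact ⟨e₁.trans e₂⟩
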